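/- Let $G$ be a finite simple graph with vertex set $\Pi$, $|\Pi|=l$ ($G$ need not be connected), and let $\chi_G(q)$ be its chromatic polynomial. Let $L_G$ be the bond lattice of $G$, i.e. the set of all partitions $\pi$ of $\Pi$ into non-empty parts each of which induces a connected subgraph of $G$, ordered by refinement ($\pi'\le\pi$ iff $\pi'$ refines $\pi$); its minimal element $\hat 0$ is the partition into singletons. Regard $L_G$ as a directed graph with an edge $\pi\to\pi'$ iff $\pi$ covers $\pi'$. If $\pi\to\pi'$, then $\pi'$ is obtained from $\pi$ by splitting exactly one part $S$ of $\pi$ into two parts $S',S''$ of $\pi'$, and we put $$w(\pi,\pi')=\frac{1}{d(\pi)}\cdot\frac{e(S',S'')}{e(S)},$$ where $d(\pi)$ is the number of non-singleton parts of $\pi$, $e(S)$ is the number of edges of $G$ with both ends in $S$, and $e(S',S'')$ is the number of edges of $G$ with one end in $S'$ and the other in $S''$. For a directed path $p:\pi_1\to\pi_2\to\cdots\to\pi_r$ in $L_G$ ($r\ge 1$) let $\operatorname{end}(p)=\pi_r$, $\operatorname{len}(p)=r-1$ and $w(p)=\prod_{i=1}^{r-1}w(\pi_i,\pi_{i+1})$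 (so $w(p)=1$ if $r=1$). Then $$\chi_G(q)=\sum_{\substack{p\text{ a directed path in }L_G\\ \operatorname{end}(p)=\hat 0}}(-1)^{\operatorname{len}(p)}\,w(p)\,q^{\,l-\operatorname{len}(p)}.$$ -/

import Mathlib

open Finset Polynomial

namespace SimpleGraph

/-! ### The chromatic polynomial -/

/-- The number `c_k(G)` of ordered partitions of the vertex set into `k` non-empty independent
sets: the colour classes of the surjective proper colourings with `k` colours. -/
noncomputable def orderedIndepPartitionCount {V : Type*} (G : SimpleGraph V) (k : ℕ) : ℕ :=
  Nat.card {c : G.Coloring (Fin k) // Function.Surjective c}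

/-- The chromatic polynomial `∑ₖ c_k(G) * (q choose k)`, where
`(q choose k) = q (q - 1) ⋯ (q - k + 1) / k!`.  By `chromaticPolynomial_eval` below it is the
polynomial whose value at each natural number `n` is the number of proper colourings of `G`
with `n` colours. -/
noncomputable def chromaticPolynomial {V : Type*} [Fintype V] (G : SimpleGraph V) : ℚ[X] :=
  ∑ k ∈ range (Fintype.card V + 1),
    C ((orderedIndepPartitionCount G k : ℚ) / (k.factorial : ℚ)) * descPochhammer ℚ k

/-- Colourings with colours in `Fin n` using exactly the colours of `T`, where `#T = k`, are
surjective colourings with `k` colours. -/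
theorem card_coloring_range_eq {V : Type*} (G : SimpleGraph V) {n k : ℕ}
    (T : Finset (Fin n)) (hT : T.card = k) :
    Nat.card {c : G.Coloring (Fin n) // Set.range c = T} = orderedIndepPartitionCount G k := by
  classical
  let e : Fin k ≃ T := (T.equivFinOfCardEq hT).symm
  refine Nat.card_congr ⟨fun c => ⟨Coloring.mk
      (fun v => e.symm ⟨c.1 v, by
        have : c.1 v ∈ Set.range c.1 := ⟨v, rfl⟩
        rw [c.2] at this; exact this⟩) ?_, ?_⟩,
    fun c => ⟨Coloring.mk (fun v => (e (c.1 v) : Fin n)) ?_, ?_⟩, ?_, ?_⟩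
  · intro v w h h'
    have := e.symm.injective h'
    exact c.1.valid h (by simpa using this)
  · intro i
    have : (e i : Fin n) ∈ Set.range c.1 := by rw [c.2]; exact (e i).2
    obtain ⟨v, hv⟩ := this
    refine ⟨v, ?_⟩
    change e.symm _ = i
    rw [Equiv.symm_apply_eq]
    exact Subtype.ext hv
  · intro v w h h'
    exact c.1.valid h (e.injective (Subtype.ext h'))
  · ext x
    constructor
    · rintro ⟨v, rfl⟩
      exact (e (c.1 v)).2
    · intro hx
      obtain ⟨v, hv⟩ := c.2 (e.symm ⟨x, hx⟩)
      refine ⟨v, ?_⟩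
      change ((e (c.1 v)) : Fin n) = x
      rw [hv]; simp
  · intro c
    apply Subtype.ext
    apply RelHom.ext
    intro v
    exact congrArg Subtype.val (e.apply_symm_apply _)
  · intro c
    apply Subtype.ext
    apply RelHom.ext
    intro v
    exact e.symm_apply_apply _

/-- The values of the chromatic polynomial count proper colourings. -/
theorem chromaticPolynomial_eval {V : Type*} [Fintype V] (G : SimpleGraph V) (n : ℕ) :
    (chromaticPolynomial G).eval (n : ℚ) = (Nat.card (G.Coloring (Fin n)) : ℚ) := by
  classical
  have : Finite (G.Coloring (Fin n)) :=
    Finite.of_injective (fun c : G.Coloring (Fin n) => (c : V → Fin n)) DFunLike.coe_injective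
  have h1 : Nat.card (G.Coloring (Fin n)) =
      ∑ T : Finset (Fin n), orderedIndepPartitionCount G T.card := by
    let f : G.Coloring (Fin n) → Finset (Fin n) := fun c => univ.image c
    rw [Nat.card_congr (Equiv.sigmaFiberEquiv f).symm, Nat.card_sigma]
    refine Finset.sum_congr rfl fun T _ => ?_
    rw [← card_coloring_range_eq G T rfl]
    refine Nat.card_congr (Equiv.subtypeEquivRight fun c => ?_)
    simp [f, ← Finset.coe_inj]
  have hzero : ∀ k, Fintype.card V < k → orderedIndepPartitionCount G k = 0 := by
    intro k hk
    have : IsEmpty {c : G.Coloring (Fin k) // Function.Surjective c} := ⟨fun c => by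
      have := Fintype.card_le_of_surjective _ c.2
      simp at this; omega⟩
    exact Nat.card_of_isEmpty
  have h2 : ∑ T : Finset (Fin n), orderedIndepPartitionCount G T.card =
      ∑ k ∈ range (n + 1), n.choose k * orderedIndepPartitionCount G k := by
    have := Finset.sum_powerset_apply_card (f := fun k => orderedIndepPartitionCount G k)
      (x := (univ : Finset (Fin n)))
    simpa using this
  have h3 : ∀ k, ∀ a : ℚ, eval (n : ℚ) (C (a / (k.factorial : ℚ)) * descPochhammer ℚ k) =
      (n.choose k : ℚ) * a := by
    intro k a
    rw [eval_mul, eval_C, descPochhammer_eval_eq_descFactorial,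
      Nat.descFactorial_eq_factorial_mul_choose]
    push_cast
    have : (k.factorial : ℚ) ≠ 0 := by exact_mod_cast k.factorial_ne_zero
    field_simp
  rw [h1, h2, chromaticPolynomial, eval_finsetSum]
  simp only [h3]
  push_cast
  have key : ∀ N, Fintype.card V ≤ N → n ≤ N →
      ∑ k ∈ range (Fintype.card V + 1), (n.choose k : ℚ) * orderedIndepPartitionCount G k =
      ∑ k ∈ range (n + 1), (n.choose k : ℚ) * orderedIndepPartitionCount G k := by
    intro N hN hn
    rw [Finset.sum_subset (s₂ := range (N + 1)), ← Finset.sum_subset (s₁ := range (n + 1))]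
    · intro k hk; simp at *; omega
    · intro k _ hk
      simp at hk
      simp [Nat.choose_eq_zero_of_lt (show n < k by omega)]
    · intro k hk; simp at *; omega
    · intro k _ hk
      simp at hk
      simp [hzero k (by omega)]
  exact key _ (le_max_left _ _) (le_max_right _ _)

/-! ### The bond lattice -/

/-- The bond lattice of `G`: the partitions of the vertex set all of whose parts induce connected
subgraphs, ordered by refinement (`π' ≤ π` iff `π'` refines `π`). -/
abbrev BondLattice {V : Type*} [Fintype V] [DecidableEq V] (G : SimpleGraph V) : Type _ :=
  {π : Finpartition (univ : Finset V) // ∀ S ∈ π.parts, (G.induce (S : Set V)).Connected}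

/-- The minimal element `0̂`, written `⊥`, is the partition into singletons. -/
instance {V : Type*} [Fintype V] [DecidableEq V] (G : SimpleGraph V) :
    OrderBot (BondLattice G) where
  bot := ⟨⊥, by
    intro S hS
    obtain ⟨a, -, rfl⟩ := Finpartition.mem_bot_iff.1 hS
    rw [Finset.coe_singleton]
    have : Nonempty ({a} : Set V) := ⟨⟨a, rfl⟩⟩
    exact { preconnected := Preconnected.of_subsingleton }⟩
  bot_le π := (bot_le : (⊥ : Finpartition (univ : Finset V)) ≤ π.1)

/-- `e(S)`: the number of edges of `G` with both ends in `S`. -/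
noncomputable def edgesWithin {V : Type*} (G : SimpleGraph V) (S : Finset V) : ℕ :=
  {e ∈ G.edgeSet | ∀ v ∈ e, v ∈ S}.ncard

/-- `e(A, B)`: the number of edges of `G` with one end in `A` and the other in `B`. -/
noncomputable def edgesAcross {V : Type*} (G : SimpleGraph V) (A B : Finset V) : ℕ :=
  {e ∈ G.edgeSet | ∃ a ∈ A, ∃ b ∈ B, e = s(a, b)}.ncard

/-- `d(π)`: the number of non-singleton parts of `π`. -/
def nonSingletonParts {V : Type*} [Fintype V] [DecidableEq V] {G : SimpleGraph V}
    (π : BondLattice G) : ℕ :=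
  #{S ∈ π.1.parts | 1 < #S}

/-- `π'` arises from `π` by splitting the part `S` of `π` into the two parts `A`, `B` of `π'`. -/
def IsSplit {V : Type*} [Fintype V] [DecidableEq V] {G : SimpleGraph V} (π π' : BondLattice G)
    (S A B : Finset V) : Prop :=
  S ∈ π.1.parts ∧ A ∈ π'.1.parts ∧ B ∈ π'.1.parts ∧ A ≠ B ∧ A ∪ B = S ∧
    π.1.parts \ {S} = π'.1.parts \ {A, B}

open Classical in
/-- The weight `w(π, π') = e(A, B) / (d(π) e(S))` of a directed edge `π → π'` of the bond lattice,
where `π'` arises from `π` by splitting `S` into `A` and `B`.  By `IsSplit.bondWeight_eq` the value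
does not depend on the choice of `S`, `A`, `B`, and by `exists_isSplit_of_covBy` they exist for
each covering relation; the value `0` elsewhere is never used. -/
noncomputable def bondWeight {V : Type*} [Fintype V] [DecidableEq V] {G : SimpleGraph V}
    (π π' : BondLattice G) : ℚ :=
  if h : ∃ t : Finset V × Finset V × Finset V, IsSplit π π' t.1 t.2.1 t.2.2 then
    (edgesAcross G h.choose.2.1 h.choose.2.2 : ℚ) /
      ((nonSingletonParts π : ℚ) * (edgesWithin G h.choose.1 : ℚ))
  else 0

theorem edgesAcross_comm {V : Type*} (G : SimpleGraph V) (A B : Finset V) :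
    edgesAcross G A B = edgesAcross G B A := by
  unfold edgesAcross
  congr 1
  ext e
  constructor
  · rintro ⟨he, a, ha, b, hb, rfl⟩
    exact ⟨he, b, hb, a, ha, Sym2.eq_swap⟩
  · rintro ⟨he, a, ha, b, hb, rfl⟩
    exact ⟨he, b, hb, a, ha, Sym2.eq_swap⟩

theorem IsSplit.sdiff_eq {V : Type*} [Fintype V] [DecidableEq V] {G : SimpleGraph V}
    {π π' : BondLattice G} {S A B : Finset V} (h : IsSplit π π' S A B) :
    π.1.parts \ π'.1.parts = {S} ∧ π'.1.parts \ π.1.parts = {A, B} := by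
  obtain ⟨hS, hA, hB, hAB, hU, hE⟩ := h
  have sub : ∀ {ρ : BondLattice G} {P Q : Finset V}, P ∈ ρ.1.parts → Q ∈ ρ.1.parts → P ⊆ Q →
      P = Q := by
    intro ρ P Q hP hQ hPQ
    obtain ⟨x, hx⟩ := ρ.1.nonempty_of_mem_parts hP
    exact ρ.1.eq_of_mem_parts hP hQ hx (hPQ hx)
  have hAS : A ⊆ S := hU ▸ subset_union_left
  have hBS : B ⊆ S := hU ▸ subset_union_right
  have hS' : S ∉ π'.1.parts := fun h => hAB ((sub hA h hAS).trans (sub hB h hBS).symm)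
  have hA' : A ∉ π.1.parts := fun h => by
    have := sub h hS hAS
    exact hAB (sub hB hA (this ▸ hBS)).symm
  have hB' : B ∉ π.1.parts := fun h => by
    have := sub h hS hBS
    exact hAB (sub hA hB (this ▸ hAS))
  have hE' : ∀ P, (P ∈ π.1.parts ∧ P ≠ S) ↔ (P ∈ π'.1.parts ∧ P ≠ A ∧ P ≠ B) := by
    intro P
    have := Finset.ext_iff.1 hE P
    simpa using this
  constructor
  · ext P
    have := hE' P
    simp only [mem_sdiff, mem_singleton]
    constructor
    · rintro ⟨h1, h2⟩
      by_contra h3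
      exact h2 (this.1 ⟨h1, h3⟩).1
    · rintro rfl
      exact ⟨hS, hS'⟩
  · ext P
    have := hE' P
    simp only [mem_sdiff, mem_insert, mem_singleton]
    constructor
    · rintro ⟨h1, h2⟩
      by_contra! h3
      exact h2 (this.2 ⟨h1, h3⟩).1
    · rintro (rfl | rfl)
      exacts [⟨hA, hA'⟩, ⟨hB, hB'⟩]

/-- The weight of an edge may be computed from any way of writing it as a splitting. -/
theorem IsSplit.bondWeight_eq {V : Type*} [Fintype V] [DecidableEq V] {G : SimpleGraph V}
    {π π' : BondLattice G} {S A B : Finset V} (h : IsSplit π π' S A B) :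
    bondWeight π π' =
      (edgesAcross G A B : ℚ) / ((nonSingletonParts π : ℚ) * (edgesWithin G S : ℚ)) := by
  have hex : ∃ t : Finset V × Finset V × Finset V, IsSplit π π' t.1 t.2.1 t.2.2 :=
    ⟨(S, A, B), h⟩
  rw [bondWeight, dif_pos hex]
  have h' := hex.choose_spec
  obtain ⟨h1, h2⟩ := h.sdiff_eq
  obtain ⟨h1', h2'⟩ := h'.sdiff_eq
  have e1 : hex.choose.1 = S := Finset.singleton_injective (h1'.symm.trans h1)
  have hne := h'.2.2.2.1
  have e2 := h2'.symm.trans h2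
  generalize hex.choose = t at *
  rw [e1]
  have hA : t.2.1 = A ∨ t.2.1 = B := by
    have : t.2.1 ∈ ({A, B} : Finset (Finset V)) := e2 ▸ by simp
    simpa using this
  have hB : t.2.2 = A ∨ t.2.2 = B := by
    have : t.2.2 ∈ ({A, B} : Finset (Finset V)) := e2 ▸ by simp
    simpa using this
  rcases hA with hA | hA <;> rcases hB with hB | hB
  · exact absurd (hA.trans hB.symm) hne
  · rw [hA, hB]
  · rw [hA, hB, edgesAcross_comm]
  · exact absurd (hA.trans hB.symm) hne

/-- Each covering relation of the bond lattice splits one part into two. -/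
theorem exists_isSplit_of_covBy {V : Type*} [Fintype V] [DecidableEq V] {G : SimpleGraph V}
    {π π' : BondLattice G} (h : π' ⋖ π) : ∃ S A B, IsSplit π π' S A B := by
  classical
  -- a part `A` of `π'` which is not a part of `π`
  obtain ⟨A, hA, hAπ⟩ : ∃ A ∈ π'.1.parts, A ∉ π.1.parts := by
    by_contra! hall
    refine not_le_of_gt h.lt ?_
    intro S hS
    obtain ⟨x, hx⟩ := π.1.nonempty_of_mem_parts hS
    obtain ⟨A, hA, hxA⟩ := π'.1.exists_mem (mem_univ x)
    exact ⟨A, hA, (π.1.eq_of_mem_parts hS (hall A hA) hx hxA).le⟩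
  obtain ⟨S, hS, hAS⟩ : ∃ S ∈ π.1.parts, A ⊆ S := h.le hA
  obtain ⟨x, hx⟩ := π'.1.nonempty_of_mem_parts hA
  obtain ⟨y, hyS, hyA⟩ : ∃ y ∈ S, y ∉ A := by
    by_contra! hcon
    exact hAπ ((subset_antisymm hAS hcon) ▸ hS)
  -- an edge of `G(S)` leaving `A`
  obtain ⟨a, b, haA, hbA, hbS, hab⟩ : ∃ a b, a ∈ A ∧ b ∉ A ∧ b ∈ S ∧ G.Adj a b := by
    obtain ⟨p⟩ := (π.2 S hS).preconnected ⟨x, hAS hx⟩ ⟨y, hyS⟩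
    obtain ⟨d, -, hd1, hd2⟩ := p.exists_boundary_dart {v | v.1 ∈ A} hx hyA
    exact ⟨d.fst, d.snd, hd1, hd2, d.snd.2, d.adj⟩
  obtain ⟨B, hB, hbB⟩ := π'.1.exists_mem (mem_univ b)
  have hAB : A ≠ B := fun e => hbA (e ▸ hbB)
  have hBS : B ⊆ S := by
    obtain ⟨S', hS', hBS'⟩ : ∃ S' ∈ π.1.parts, B ⊆ S' := h.le hB
    exact (π.1.eq_of_mem_parts hS' hS (hBS' hbB) hbS) ▸ hBS'
  have hconn : (G.induce ((A ∪ B : Finset V) : Set V)).Connected := by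
    have h1 := induce_union_connected (π'.2 A hA).preconnected
      (induce_pair_connected_of_adj hab).preconnected ⟨a, haA, by simp⟩
    have h2 := induce_union_connected h1.preconnected (π'.2 B hB).preconnected
      ⟨b, by simp, hbB⟩
    have e : ((A ∪ B : Finset V) : Set V) = ((A : Set V) ∪ {a, b}) ∪ (B : Set V) := by
      ext v
      simp only [coe_union, Set.mem_union, mem_coe, Set.mem_insert_iff, Set.mem_singleton_iff]
      constructor
      · tauto
      · rintro ((h | rfl | rfl) | h)
        exacts [Or.inl h, Or.inl haA, Or.inr hbB, Or.inr h]
    rw [e]; exact h2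
  -- merge `A` and `B`
  let Q : Finset (Finset V) := insert (A ∪ B) (π'.1.parts \ {A, B})
  have hQ : ∀ P, P ∈ Q ↔ P = A ∪ B ∨ (P ∈ π'.1.parts ∧ P ≠ A ∧ P ≠ B) := by
    intro P; simp [Q]
  have hex : ∀ v ∈ (univ : Finset V), ∃! t, t ∈ Q ∧ v ∈ t := by
    intro v _
    obtain ⟨P, hP, hvP⟩ := π'.1.exists_mem (mem_univ v)
    by_cases hPAB : P = A ∨ P = B
    · have hv : v ∈ A ∪ B := by
        rcases hPAB with rfl | rfl
        exacts [mem_union_left _ hvP, mem_union_right _ hvP]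
      refine ⟨A ∪ B, ⟨(hQ _).2 (Or.inl rfl), hv⟩, ?_⟩
      rintro t ⟨ht, hvt⟩
      rcases (hQ t).1 ht with rfl | ⟨ht, htA, htB⟩
      · rfl
      · have := π'.1.eq_of_mem_parts ht hP hvt hvP
        subst this
        tauto
    · push Not at hPAB
      refine ⟨P, ⟨(hQ _).2 (Or.inr ⟨hP, hPAB⟩), hvP⟩, ?_⟩
      rintro t ⟨ht, hvt⟩
      rcases (hQ t).1 ht with rfl | ⟨ht, htA, htB⟩
      · rcases mem_union.1 hvt with hv | hv
        · exact absurd (π'.1.eq_of_mem_parts hP hA hvP hv) hPAB.1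
        · exact absurd (π'.1.eq_of_mem_parts hP hB hvP hv) hPAB.2
      · exact π'.1.eq_of_mem_parts ht hP hvt hvP
  have hne : ∅ ∉ Q := by
    intro h0
    rcases (hQ _).1 h0 with h0 | ⟨h0, -, -⟩
    · have : a ∈ A ∪ B := mem_union_left _ haA
      rw [← h0] at this
      simp at this
    · exact π'.1.empty_notMem_parts h0
  let ρ : BondLattice G := ⟨Finpartition.ofExistsUnique Q (fun _ _ => subset_univ _) hex hne, by
    intro P hP
    rcases (hQ P).1 hP with rfl | ⟨hP, -, -⟩
    exacts [hconn, π'.2 P hP]⟩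
  have hρ : ρ.1.parts = Q := rfl
  have hle : π' ≤ ρ := by
    intro P hP
    by_cases hPAB : P = A ∨ P = B
    · refine ⟨A ∪ B, (hQ _).2 (Or.inl rfl), ?_⟩
      rcases hPAB with rfl | rfl
      exacts [subset_union_left, subset_union_right]
    · push Not at hPAB
      exact ⟨P, (hQ _).2 (Or.inr ⟨hP, hPAB⟩), le_rfl⟩
  have hlt : π' < ρ := by
    refine lt_of_le_of_ne hle fun e => ?_
    have : A ∈ ρ.1.parts := e ▸ hA
    rcases (hQ A).1 this with h1 | ⟨-, h1, -⟩
    · exact hbA (h1 ▸ mem_union_right _ hbB)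
    · exact h1 rfl
  have hρπ : ρ ≤ π := by
    intro P hP
    rcases (hQ P).1 hP with rfl | ⟨hP, -, -⟩
    · exact ⟨S, hS, union_subset hAS hBS⟩
    · exact h.le hP
  have heq : ρ = π := by
    by_contra hn
    exact h.2 hlt (lt_of_le_of_ne hρπ hn)
  subst heq
  have hABQ : A ∪ B ∈ ρ.1.parts := (hQ _).2 (Or.inl rfl)
  refine ⟨A ∪ B, A, B, hABQ, hA, hB, hAB, rfl, ?_⟩
  rw [hρ]
  ext P
  have hABn : A ∪ B ∉ π'.1.parts \ {A, B} := by
    intro hm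
    have hm' := (mem_sdiff.1 hm)
    have := π'.1.eq_of_mem_parts hm'.1 hA (mem_union_left _ haA) haA
    exact hm'.2 (by simp [this])
  simp only [Q, mem_sdiff, mem_insert, mem_singleton]
  constructor
  · rintro ⟨h1 | h1, h2⟩
    exacts [absurd h1 h2, h1]
  · intro h1
    refine ⟨Or.inr h1, ?_⟩
    rintro rfl
    exact hABn (by simpa using h1)

/-! ### Directed paths in the bond lattice -/

/-- A directed path `π₁ → ⋯ → πᵣ` (`r ≥ 1`) in the bond lattice, where there is a directed edge
`π → π'` iff `π` covers `π'`; its `length` is `r - 1` and its endpoint `πᵣ` is `last`. -/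
abbrev BondPath {V : Type*} [Fintype V] [DecidableEq V] (G : SimpleGraph V) : Type _ :=
  RelSeries {x : BondLattice G × BondLattice G | x.2 ⋖ x.1}

/-- There are only finitely many directed paths in the bond lattice. -/
theorem finite_bondPath {V : Type*} [Fintype V] [DecidableEq V] (G : SimpleGraph V) :
    Finite (BondPath G) := by
  classical
  have : Finite (BondLattice G) := inferInstance
  have : Fintype (BondLattice G) := Fintype.ofFinite _
  have hnodup : ∀ p : BondPath G, p.toList.Nodup := by
    intro p
    have h1 : p.toList.IsChain (fun a b => b < a) :=
      p.isChain_toList.imp fun a b (hab : b ⋖ a) => hab.lt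
    have : IsTrans (BondLattice G) (fun a b => b < a) := ⟨fun a b c h h' => h'.trans h⟩
    exact (List.isChain_iff_pairwise.1 h1).imp fun hab => (ne_of_lt hab).symm
  exact Finite.of_injective
    (fun p : BondPath G => (⟨p.toList, hnodup p⟩ : {l : List (BondLattice G) // l.Nodup}))
    fun p p' hp => RelSeries.toList_injective (congrArg Subtype.val hp)

noncomputable instance {V : Type*} [Fintype V] [DecidableEq V] (G : SimpleGraph V) :
    Fintype (BondPath G) :=
  @Fintype.ofFinite _ (finite_bondPath G)

/-- The weight of a path: the product of the weights of its edges. -/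
noncomputable def BondPath.weight {V : Type*} [Fintype V] [DecidableEq V] {G : SimpleGraph V}
    (p : BondPath G) : ℚ :=
  ∏ i : Fin p.length, bondWeight (p i.castSucc) (p i.succ)

end SimpleGraph

/-!
For a set `F` of edges of `G`, the vertex sets of the connected components of `(V, F)` form a bond
`componentBond G F`.  Whitney's expansion, `chromaticPolynomial_eq_sum_powerset`, says
`χ_G(q) = ∑ (-1) ^ #F * q ^ k(F)`, where `F` runs over all sets of edges and `k(F)` is the number of
components.  Grouped by components it reads `χ_G(q) = ∑ signedCount π * q ^ #π.parts`, where `π` runs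
over the bond lattice and `signedCount π` is the sum of `(-1) ^ #F` over all `F` with components `π`.

The weights enter through a recursion for `signedCount`.  Fix a bond `π` and an edge `ab` of `G`
within a part of `π`.  Inserting or deleting `ab` pairs off, with opposite signs, the sets `F` with
components `π`, except for those `F` in which `ab` is a bridge; for these, deleting `ab` leaves a set
whose components form a bond `ρ` covered by `π` in which `a` and `b` are separated, and every such
set arises.  Hence `signedCount π = -∑ signedCount ρ`, the sum being over the bonds `ρ` covered by
`π` that separate `a` from `b` (`sum_signedCount_of_adj`).  The weight `w(π, ρ)` is the probability
that `ρ` separates the ends of a random edge: choose a non-singleton part of `π` uniformly, then an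
edge within it uniformly.  Averaging the identity over this edge gives
`signedCount π = -∑ w(π, ρ) * signedCount ρ` for `π ≠ 0̂`, the sum now being over all `ρ` covered
by `π` (`sum_bondWeight_mul_signedCount`).

The sum of `(-1) ^ len p * w(p)` over the paths from `π` to `0̂` satisfies the same recursion, by
removal of the first edge, and both quantities are `1` at `0̂`; so they agree.  Since each step of a
path increases the number of parts by one, a path `p` from `π` to `0̂` satisfies
`#π.parts = #V - len p`, and grouping the paths by their first vertex gives the theorem.
-/

namespace SimpleGraph

/-! ### The bond of components of a set of edges -/

section ComponentBond

variable {V : Type*} [Fintype V] [DecidableEq V] {G : SimpleGraph V}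

theorem BondLattice.le_iff {π ρ : BondLattice G} :
    π ≤ ρ ↔ ∀ u v, v ∈ π.1.part u → v ∈ ρ.1.part u := by
  constructor
  · intro h u v hv
    obtain ⟨S, hS, hle⟩ : ∃ S ∈ ρ.1.parts, π.1.part u ⊆ S := h (π.1.part_mem.2 (mem_univ u))
    rw [ρ.1.part_eq_of_mem hS (hle (π.1.mem_part_self.2 (mem_univ u)))]
    exact hle hv
  · intro h S hS
    obtain ⟨x, hx⟩ := π.1.nonempty_of_mem_parts hS
    refine ⟨ρ.1.part x, ρ.1.part_mem.2 (mem_univ x), fun v hv => h x v ?_⟩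
    rwa [π.1.part_eq_of_mem hS hx]

theorem BondLattice.mem_part_symm {π : BondLattice G} {u v : V} (h : v ∈ π.1.part u) :
    u ∈ π.1.part v := by
  rw [π.1.mem_part_iff_exists] at h ⊢
  obtain ⟨S, hS, h1, h2⟩ := h
  exact ⟨S, hS, h2, h1⟩

theorem BondLattice.mem_part_trans {π : BondLattice G} {u v w : V} (h : v ∈ π.1.part u)
    (h' : w ∈ π.1.part v) : w ∈ π.1.part u := by
  rwa [← (π.1.mem_part_iff_part_eq_part (mem_univ v) (mem_univ u)).1 h]

variable (G) in
open Classical in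
/-- The bond of `G` whose parts are the connected components of the spanning subgraph with edge
set `F`.  Elements of `F` that are not edges of `G` are ignored, so that the definition makes sense
for each `F`. -/
noncomputable def componentBond (F : Finset (Sym2 V)) : BondLattice G :=
  ⟨Finpartition.ofSetoid (G ⊓ fromEdgeSet (F : Set (Sym2 V))).reachableSetoid, by
    intro S hS
    obtain ⟨x, hx⟩ := Finpartition.nonempty_of_mem_parts _ hS
    have hSx : (S : Set V) =
        ((G ⊓ fromEdgeSet (F : Set (Sym2 V))).connectedComponentMk x).supp := by
      ext v
      rw [← Finpartition.part_eq_of_mem _ hS hx, mem_coe, Finpartition.mem_part_ofSetoid_iff_rel,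
        ConnectedComponent.mem_supp_iff, ConnectedComponent.eq]
      exact ⟨Reachable.symm, Reachable.symm⟩
    rw [hSx]
    exact (ConnectedComponent.connected_toSimpleGraph _).mono
      (comap_monotone _ inf_le_left)⟩

theorem mem_part_componentBond {F : Finset (Sym2 V)} {u v : V} :
    v ∈ (componentBond G F).1.part u ↔
      (G ⊓ fromEdgeSet (F : Set (Sym2 V))).Reachable u v := by
  classical
  exact Finpartition.mem_part_ofSetoid_iff_rel

/-- The components of `F` refine `π` as soon as each edge in `F` lies within a part of `π`. -/
theorem componentBond_le_iff {F : Finset (Sym2 V)} {π : BondLattice G} :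
    componentBond G F ≤ π ↔
      ∀ u v, G.Adj u v → s(u, v) ∈ F → v ∈ π.1.part u := by
  rw [BondLattice.le_iff]
  simp only [mem_part_componentBond]
  constructor
  · intro h u v huv hF
    exact h u v (Adj.reachable (by simp [huv, hF, huv.ne]))
  · rintro h u v ⟨p⟩
    induction p with
    | nil => exact π.1.mem_part_self.2 (mem_univ _)
    | cons hab _ ih =>
      rw [inf_adj, fromEdgeSet_adj] at hab
      exact BondLattice.mem_part_trans (h _ _ hab.1 hab.2.1) ih

theorem componentBond_mono {F F' : Finset (Sym2 V)} (h : F ⊆ F') :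
    componentBond G F ≤ componentBond G F' := by
  rw [componentBond_le_iff]
  intro u v huv hF
  exact mem_part_componentBond.2 (Adj.reachable (by simp [huv, h hF, huv.ne]))

/-- Inserting an edge within a part of `π` makes the components of `F` equal to `π` iff they were
equal to `π` before, or `π` covers them and the edge runs between two of them. -/
theorem componentBond_insert_eq_iff {F : Finset (Sym2 V)} {π : BondLattice G} {a b : V}
    (hab : G.Adj a b) (hπ : b ∈ π.1.part a) :
    componentBond G (insert s(a, b) F) = π ↔
      componentBond G F = π ∨
        (componentBond G F ⋖ π ∧ b ∉ (componentBond G F).1.part a) := by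
  have insert_le : ∀ {ρ : BondLattice G}, componentBond G F ≤ ρ → b ∈ ρ.1.part a →
      componentBond G (insert s(a, b) F) ≤ ρ := by
    intro ρ h hb
    rw [componentBond_le_iff] at h ⊢
    intro u v huv hF
    rcases mem_insert.1 hF with hF | hF
    · rcases Sym2.eq_iff.1 hF with ⟨rfl, rfl⟩ | ⟨rfl, rfl⟩
      exacts [hb, BondLattice.mem_part_symm hb]
    · exact h u v huv hF
  have hmono := componentBond_mono (G := G) (subset_insert s(a, b) F)
  have hmem : b ∈ (componentBond G (insert s(a, b) F)).1.part a :=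
    mem_part_componentBond.2 (Adj.reachable (by simp [hab, hab.ne]))
  constructor
  · intro h
    by_cases hb : b ∈ (componentBond G F).1.part a
    · exact Or.inl ((le_antisymm hmono (insert_le le_rfl hb)).trans h)
    · refine Or.inr ⟨⟨lt_of_le_of_ne (h ▸ hmono) fun e => hb (e ▸ hπ), ?_⟩, hb⟩
      intro ρ h1 h2
      have hbρ : b ∉ ρ.1.part a := fun hbρ => h2.not_ge (h ▸ insert_le h1.le hbρ)
      -- a pair joined in `π` is joined by `F`, or becomes so through the new edge
      have key : ∀ u v, (G ⊓ fromEdgeSet ((insert s(a, b) F : Finset _) : Set (Sym2 V))).Reachable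
          u v → v ∈ (componentBond G F).1.part u ∨
            (a ∈ (componentBond G F).1.part u ∧ v ∈ (componentBond G F).1.part b) ∨
            (b ∈ (componentBond G F).1.part u ∧ v ∈ (componentBond G F).1.part a) := by
        rintro u v ⟨p⟩
        induction p with
        | nil => exact Or.inl (Finpartition.mem_part_self _ |>.2 (mem_univ _))
        | @cons x y z hxy _ ih =>
          rw [inf_adj, fromEdgeSet_adj, mem_coe, mem_insert] at hxy
          obtain ⟨hG, hF | hF, hne⟩ := hxy
          · rcases Sym2.eq_iff.1 hF with ⟨rfl, rfl⟩ | ⟨rfl, rfl⟩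
            · have := Finpartition.mem_part_self (componentBond G F).1 |>.2 (mem_univ x)
              tauto
            · have := Finpartition.mem_part_self (componentBond G F).1 |>.2 (mem_univ x)
              tauto
          · have hxy : y ∈ (componentBond G F).1.part x :=
              mem_part_componentBond.2 (Adj.reachable (by simp [hG, hF, hne]))
            rcases ih with ih | ⟨ih, ih'⟩ | ⟨ih, ih'⟩
            · exact Or.inl (BondLattice.mem_part_trans hxy ih)
            · exact Or.inr (Or.inl ⟨BondLattice.mem_part_trans hxy ih, ih'⟩)
            · exact Or.inr (Or.inr ⟨BondLattice.mem_part_trans hxy ih, ih'⟩)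
      refine h1.not_ge (BondLattice.le_iff.2 fun u v huv => ?_)
      have hle := BondLattice.le_iff.1 h1.le
      have huv' := BondLattice.le_iff.1 h2.le u v huv
      rw [← h, mem_part_componentBond] at huv'
      rcases key u v huv' with h' | ⟨h', h''⟩ | ⟨h', h''⟩
      · exact h'
      · exact absurd (BondLattice.mem_part_trans (BondLattice.mem_part_symm (hle _ _ h'))
          (BondLattice.mem_part_trans huv (BondLattice.mem_part_symm (hle _ _ h'')))) hbρ
      · exact absurd (BondLattice.mem_part_trans (hle _ _ h'')
          (BondLattice.mem_part_trans (BondLattice.mem_part_symm huv) (hle _ _ h'))) hbρ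
  · rintro (h | ⟨h, hb⟩)
    · exact le_antisymm (insert_le h.le hπ) (h ▸ hmono)
    · by_contra hne
      refine h.2 (lt_of_le_of_ne hmono fun e => hb (e ▸ hmem)) ?_
      exact lt_of_le_of_ne (insert_le h.le hπ) hne

end ComponentBond

/-! ### Whitney's expansion of the chromatic polynomial -/

section ChromaticPolynomial

variable {V : Type*} [Fintype V] [DecidableEq V] {G : SimpleGraph V}

open Classical in
/-- The functions that are constant on the parts of `π` are the functions on the set of parts. -/
theorem card_constant_on_parts (π : Finpartition (univ : Finset V)) (n : ℕ) :
    #{c : V → Fin n | ∀ u v, v ∈ π.part u → c u = c v} = n ^ #π.parts := by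
  have e : {c : V → Fin n // ∀ u v, v ∈ π.part u → c u = c v} ≃ (π.parts → Fin n) :=
    { toFun := fun c S => c.1 (π.nonempty_of_mem_parts S.2).choose
      invFun := fun g => ⟨fun v => g ⟨π.part v, π.part_mem.2 (mem_univ v)⟩, fun u v h => by
        have := (π.mem_part_iff_part_eq_part (mem_univ v) (mem_univ u)).1 h
        simp only [this]⟩
      left_inv := fun c => Subtype.ext (funext fun v => (c.2 v _
        (π.nonempty_of_mem_parts (π.part_mem.2 (mem_univ v))).choose_spec).symm)
      right_inv := fun g => funext fun S => by
        refine congrArg g (Subtype.ext ?_)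
        exact (π.part_eq_of_mem S.2 (π.nonempty_of_mem_parts S.2).choose_spec) }
  rw [← Fintype.card_subtype, Fintype.card_congr e]
  simp

open Classical in
/-- Whitney's expansion of the chromatic polynomial over the sets of edges. -/
theorem chromaticPolynomial_eq_sum_powerset (G : SimpleGraph V) :
    G.chromaticPolynomial = ∑ F ∈ G.edgeFinset.powerset,
      C ((-1) ^ #F) * X ^ #(componentBond G F).1.parts := by
  refine Polynomial.eq_of_infinite_eval_eq _ _
    ((Set.infinite_range_of_injective (Nat.cast_injective (R := ℚ))).mono ?_)
  rintro _ ⟨n, rfl⟩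
  change eval _ _ = eval _ _
  rw [chromaticPolynomial_eval, eval_finsetSum]
  simp only [eval_mul, eval_C, eval_pow, eval_X]
  -- a colouring is proper iff no edge is mapped to the diagonal
  have h1 : Nat.card (G.Coloring (Fin n)) =
      #{c : V → Fin n | ∀ e ∈ G.edgeFinset, ¬ (e.map c).IsDiag} := by
    rw [← Fintype.card_subtype, ← Nat.card_eq_fintype_card]
    refine Nat.card_congr ⟨fun c => ⟨c, ?_⟩, fun c => Coloring.mk c.1 ?_, ?_, ?_⟩
    · intro e he
      induction e with | _ a b
      simpa using c.valid (by simpa using he)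
    · intro a b hab
      simpa using c.2 s(a, b) (by simpa using hab)
    · intro c; rfl
    · intro c; rfl
  have h2 : ∀ F ∈ G.edgeFinset.powerset, ((n : ℚ) ^ #(componentBond G F).1.parts) =
      ∑ c : V → Fin n, if ∀ e ∈ F, (e.map c).IsDiag then 1 else 0 := by
    intro F hF
    rw [← Nat.cast_pow, ← card_constant_on_parts, sum_boole]
    congr 2
    ext c
    simp only [mem_filter, mem_univ, true_and, mem_part_componentBond]
    constructor
    · intro h e he
      have heG := mem_powerset.1 hF he
      induction e with | _ a b
      rw [mem_edgeFinset, mem_edgeSet] at heG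
      simpa using h a b (Adj.reachable (by simp [heG, he, heG.ne]))
    · rintro h u v ⟨p⟩
      induction p with
      | nil => rfl
      | cons hab _ ih =>
        rw [inf_adj, fromEdgeSet_adj] at hab
        exact (by simpa using h _ hab.2.1 : _ = _).trans ih
  have h3 : ∀ c : V → Fin n, (if ∀ e ∈ G.edgeFinset, ¬ (e.map c).IsDiag then (1 : ℚ) else 0) =
      ∑ F ∈ G.edgeFinset.powerset, (-1) ^ #F * if ∀ e ∈ F, (e.map c).IsDiag then 1 else 0 := by
    intro c
    have := prod_add_one (R := ℚ) (f := fun e : Sym2 V => -if (e.map c).IsDiag then (1 : ℚ) else 0)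
      G.edgeFinset
    simp only [prod_neg, prod_boole] at this
    refine Eq.trans ?_ (this.trans (sum_congr rfl fun F _ => by congr))
    trans ∏ e ∈ G.edgeFinset, if ¬ (e.map c).IsDiag then (1 : ℚ) else 0
    · rw [prod_boole]
      congr
    refine prod_congr rfl fun e _ => ?_
    split_ifs <;> simp_all
  rw [h1, ← sum_boole, sum_congr rfl fun c _ => h3 c, sum_comm]
  refine sum_congr rfl fun F hF => ?_
  rw [h2 F hF, mul_sum]

end ChromaticPolynomial

/-! ### The recursion for the signed counts of edge sets -/

section SignedCount

variable {V : Type*} [Fintype V] [DecidableEq V] {G : SimpleGraph V}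

open Classical in
/-- The signed number `∑ (-1) ^ #F` of the sets `F` of edges of `G` whose connected components are
the parts of `π`.  It is the value `μ(0̂, π)` of the Möbius function of the bond lattice. -/
noncomputable def signedCount (π : BondLattice G) : ℚ :=
  ∑ F ∈ G.edgeFinset.powerset with componentBond G F = π, (-1) ^ #F

open Classical in
/-- Deleting and inserting an edge `ab` within a part of `π` cancels all edge sets counted by
`signedCount π`, except those in which `ab` is a bridge. -/
theorem sum_signedCount_of_adj {π : BondLattice G} {a b : V} (hab : G.Adj a b)
    (hπ : b ∈ π.1.part a) :
    ∑ ρ : BondLattice G with ρ ⋖ π ∧ b ∉ ρ.1.part a, signedCount ρ = -signedCount π := by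
  have hE : G.edgeFinset = insert s(a, b) (G.edgeFinset.erase s(a, b)) :=
    (insert_erase (by simpa using hab)).symm
  have hne : s(a, b) ∉ G.edgeFinset.erase s(a, b) := notMem_erase _ _
  have h1 : ∑ ρ : BondLattice G with ρ ⋖ π ∧ b ∉ ρ.1.part a, signedCount ρ =
      ∑ F ∈ G.edgeFinset.powerset,
        if componentBond G F ⋖ π ∧ b ∉ (componentBond G F).1.part a then (-1 : ℚ) ^ #F else 0 := by
    simp only [signedCount, sum_filter (s := G.edgeFinset.powerset)]
    rw [sum_comm]
    refine sum_congr rfl fun F _ => ?_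
    rw [sum_ite_eq]
    simp
  rw [h1, signedCount, sum_filter, hE, sum_powerset_insert hne, sum_powerset_insert hne,
    ← sum_add_distrib, ← sum_add_distrib, ← sum_neg_distrib]
  refine sum_congr rfl fun F hF => ?_
  have hF' : s(a, b) ∉ F := fun h => hne (mem_powerset.1 hF h)
  have hmem : b ∈ (componentBond G (insert s(a, b) F)).1.part a :=
    mem_part_componentBond.2 (Adj.reachable (by simp [hab, hab.ne]))
  rw [card_insert_of_notMem hF', pow_succ]
  simp only [componentBond_insert_eq_iff hab hπ, hmem, not_true_eq_false, and_false, if_false]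
  by_cases h : componentBond G F = π
  · simp [h]
  · simp only [h, if_false, false_or]
    split_ifs <;> simp

open Classical in
theorem edgesWithin_eq_card (S : Finset V) :
    edgesWithin G S = #{e ∈ G.edgeFinset | ∀ v ∈ e, v ∈ S} := by
  rw [edgesWithin, ← Set.ncard_coe_finset]
  congr 1
  ext e
  simp

open Classical in
/-- The edges across a splitting `S = A ∪ B` are the edges within `S` that lie within no part of
the finer partition. -/
theorem IsSplit.edgesAcross_eq_card {π ρ : BondLattice G} {S A B : Finset V}
    (h : IsSplit π ρ S A B) :
    edgesAcross G A B =
      #{e ∈ G.edgeFinset | (∀ v ∈ e, v ∈ S) ∧ ¬ ∃ T ∈ ρ.1.parts, ∀ v ∈ e, v ∈ T} := by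
  obtain ⟨-, hA, hB, hAB, rfl, -⟩ := h
  rw [edgesAcross, ← Set.ncard_coe_finset]
  congr 1
  ext e
  induction e with | _ x y
  simp only [Set.mem_ofPred_eq, mem_edgeSet, coe_filter, mem_edgeFinset, Sym2.mem_iff,
    forall_eq_or_imp, forall_eq, mem_union]
  refine and_congr_right fun hxy => ⟨?_, ?_⟩
  · have key : ∀ {a b}, a ∈ A → b ∈ B → ¬ ∃ T ∈ ρ.1.parts, a ∈ T ∧ b ∈ T := by
      rintro a b ha hb ⟨T, hT, haT, hbT⟩
      exact hAB ((ρ.1.eq_of_mem_parts hA hT ha haT).trans (ρ.1.eq_of_mem_parts hT hB hbT hb))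
    rintro ⟨a, ha, b, hb, he⟩
    rcases Sym2.eq_iff.1 he with ⟨rfl, rfl⟩ | ⟨rfl, rfl⟩
    · exact ⟨⟨Or.inl ha, Or.inr hb⟩, key ha hb⟩
    · refine ⟨⟨Or.inr hb, Or.inl ha⟩, fun ⟨T, hT, h1, h2⟩ => key ha hb ⟨T, hT, h2, h1⟩⟩
  · rintro ⟨⟨hx | hx, hy | hy⟩, hn⟩
    · exact absurd ⟨A, hA, hx, hy⟩ hn
    · exact ⟨x, hx, y, hy, rfl⟩
    · exact ⟨y, hy, x, hx, Sym2.eq_swap⟩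
    · exact absurd ⟨B, hB, hx, hy⟩ hn

theorem IsSplit.one_lt_card {π ρ : BondLattice G} {S A B : Finset V}
    (h : IsSplit π ρ S A B) : 1 < #S := by
  obtain ⟨-, hA, hB, hAB, rfl, -⟩ := h
  obtain ⟨x, hx⟩ := ρ.1.nonempty_of_mem_parts hA
  obtain ⟨y, hy⟩ := ρ.1.nonempty_of_mem_parts hB
  refine Finset.one_lt_card.2 ⟨x, mem_union_left _ hx, y, mem_union_right _ hy, ?_⟩
  rintro rfl
  exact hAB (ρ.1.eq_of_mem_parts hA hB hx hy)

open Classical in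
/-- The weight of a covering as a sum over all non-singleton parts of the coarser partition: the
parts that are not split contribute `0`, as all their edges lie within parts of the finer one. -/
theorem bondWeight_eq_sum {π ρ : BondLattice G} (h : ρ ⋖ π) :
    bondWeight π ρ = ∑ S ∈ π.1.parts with 1 < #S,
      (#{e ∈ G.edgeFinset | (∀ v ∈ e, v ∈ S) ∧ ¬ ∃ T ∈ ρ.1.parts, ∀ v ∈ e, v ∈ T} : ℚ) /
        ((nonSingletonParts π : ℚ) * (edgesWithin G S : ℚ)) := by
  obtain ⟨S, A, B, hs⟩ := exists_isSplit_of_covBy h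
  rw [hs.bondWeight_eq, hs.edgesAcross_eq_card]
  symm
  refine sum_eq_single_of_mem S (mem_filter.2 ⟨hs.1, hs.one_lt_card⟩) ?_
  intro T hT hTS
  have hTρ : T ∈ ρ.1.parts := by
    have : T ∈ π.1.parts \ {S} := by simp [(mem_filter.1 hT).1, hTS]
    rw [hs.2.2.2.2.2] at this
    exact (mem_sdiff.1 this).1
  rw [filter_eq_empty_iff.2]
  · simp
  · rintro e - ⟨h1, h2⟩
    exact h2 ⟨T, hTρ, h1⟩

theorem edgesWithin_ne_zero {π : BondLattice G} {S : Finset V} (hS : S ∈ π.1.parts)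
    (h : 1 < #S) : edgesWithin G S ≠ 0 := by
  classical
  obtain ⟨x, hx, y, hy, hxy⟩ := Finset.one_lt_card.1 h
  have : Nontrivial (S : Set V) := ⟨⟨x, hx⟩, ⟨y, hy⟩, by simpa using hxy⟩
  obtain ⟨z, hz⟩ := (π.2 S hS).preconnected.exists_adj_of_nontrivial ⟨x, hx⟩
  rw [edgesWithin_eq_card, card_ne_zero]
  refine ⟨s(x, z), mem_filter.2 ⟨by simpa using hz, ?_⟩⟩
  intro v hv
  rcases Sym2.mem_iff.1 hv with rfl | rfl
  exacts [hx, z.2]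

theorem nonSingletonParts_ne_zero {π : BondLattice G} (h : π ≠ ⊥) : nonSingletonParts π ≠ 0 := by
  intro h0
  rw [nonSingletonParts, card_eq_zero, filter_eq_empty_iff] at h0
  refine h (le_bot_iff.1 (BondLattice.le_iff.2 fun u v huv => ?_))
  have hu := π.1.mem_part_self.2 (mem_univ u)
  have := h0 (π.1.part_mem.2 (mem_univ u))
  rw [card_le_one.1 (not_lt.1 this) v huv u hu]
  exact Finpartition.mem_part_self _ |>.2 (mem_univ u)

open Classical in
/-- The recursion that the signed counts share with the sums over paths. -/
theorem sum_bondWeight_mul_signedCount {π : BondLattice G} (h : π ≠ ⊥) :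
    ∑ ρ : BondLattice G with ρ ⋖ π, bondWeight π ρ * signedCount ρ = -signedCount π := by
  have hd : (nonSingletonParts π : ℚ) ≠ 0 := by exact_mod_cast nonSingletonParts_ne_zero h
  -- for each part `S`, the edges within `S` contribute `-signedCount π` each
  have key : ∀ S ∈ π.1.parts, ∑ ρ : BondLattice G with ρ ⋖ π,
      (#{e ∈ G.edgeFinset | (∀ v ∈ e, v ∈ S) ∧ ¬ ∃ T ∈ ρ.1.parts, ∀ v ∈ e, v ∈ T} : ℚ) *
        signedCount ρ = edgesWithin G S * -signedCount π := by
    intro S hS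
    rw [edgesWithin_eq_card, ← nsmul_eq_mul, ← sum_const]
    simp only [← filter_filter (fun e : Sym2 V => ∀ v ∈ e, v ∈ S), card_filter _ (filter _ _),
      Nat.cast_sum, sum_mul]
    rw [sum_comm]
    refine sum_congr rfl fun e he => ?_
    induction e with | _ a b
    simp only [mem_filter, mem_edgeFinset, mem_edgeSet, Sym2.mem_iff, forall_eq_or_imp,
      forall_eq] at he
    have hb : b ∈ π.1.part a := π.1.mem_part_iff_exists.2 ⟨S, hS, he.2.2, he.2.1⟩
    rw [← sum_signedCount_of_adj he.1 hb, ← filter_filter, sum_filter (p := fun ρ => b ∉ _)]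
    refine sum_congr rfl fun ρ _ => ?_
    have : (∃ T ∈ ρ.1.parts, ∀ v ∈ s(a, b), v ∈ T) ↔ b ∈ ρ.1.part a := by
      simp only [Sym2.mem_iff, forall_eq_or_imp, forall_eq, Finpartition.mem_part_iff_exists,
        and_comm]
    simp only [this]
    split_ifs <;> simp
  have h1 : ∀ ρ ∈ ({ρ | ρ ⋖ π} : Finset (BondLattice G)), bondWeight π ρ * signedCount ρ =
      ∑ S ∈ π.1.parts with 1 < #S, ((nonSingletonParts π : ℚ) * (edgesWithin G S : ℚ))⁻¹ *
      (#{e ∈ G.edgeFinset | (∀ v ∈ e, v ∈ S) ∧ ¬ ∃ T ∈ ρ.1.parts, ∀ v ∈ e, v ∈ T} *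
        signedCount ρ) := by
    intro ρ hρ
    rw [bondWeight_eq_sum (mem_filter.1 hρ).2, sum_mul]
    exact sum_congr rfl fun S _ => by ring
  rw [sum_congr rfl h1, sum_comm]
  have h2 : ∀ S ∈ ({S ∈ π.1.parts | 1 < #S} : Finset (Finset V)),
      ∑ ρ : BondLattice G with ρ ⋖ π, ((nonSingletonParts π : ℚ) * (edgesWithin G S : ℚ))⁻¹ *
      (#{e ∈ G.edgeFinset | (∀ v ∈ e, v ∈ S) ∧ ¬ ∃ T ∈ ρ.1.parts, ∀ v ∈ e, v ∈ T} *
        signedCount ρ) = (nonSingletonParts π : ℚ)⁻¹ * -signedCount π := by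
    intro S hS
    have he : (edgesWithin G S : ℚ) ≠ 0 := by
      exact_mod_cast edgesWithin_ne_zero (mem_filter.1 hS).1 (mem_filter.1 hS).2
    rw [← mul_sum, key S (mem_filter.1 hS).1]
    field_simp
  rw [sum_congr rfl h2, sum_const, nsmul_eq_mul]
  change (nonSingletonParts π : ℚ) * _ = _
  field_simp

theorem signedCount_bot : signedCount (⊥ : BondLattice G) = 1 := by
  classical
  have : G.edgeFinset.powerset.filter (fun F => componentBond G F = ⊥) = {∅} := by
    ext F
    rw [mem_filter, mem_powerset, mem_singleton, ← le_bot_iff, componentBond_le_iff]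
    constructor
    · rintro ⟨hF, h⟩
      refine eq_empty_of_forall_notMem fun e he => ?_
      have heG := hF he
      induction e with | _ a b
      rw [mem_edgeFinset, mem_edgeSet] at heG
      obtain ⟨S, hS, h1, h2⟩ := Finpartition.mem_part_iff_exists _ |>.1 (h a b heG he)
      obtain ⟨c, -, rfl⟩ := Finpartition.mem_bot_iff.1 hS
      exact heG.ne ((mem_singleton.1 h2).trans (mem_singleton.1 h1).symm)
    · rintro rfl
      simp
  simp only [signedCount, this, sum_singleton, card_empty, pow_zero]

end SignedCount

/-! ### Sums over paths -/

section Paths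

variable {V : Type*} [Fintype V] [DecidableEq V] {G : SimpleGraph V}

theorem IsSplit.card_parts {π ρ : BondLattice G} {S A B : Finset V} (h : IsSplit π ρ S A B) :
    #ρ.1.parts = #π.1.parts + 1 := by
  obtain ⟨hS, hA, hB, hAB, -, hE⟩ := h
  have h1 := card_sdiff_add_card_eq_card (singleton_subset_iff.2 hS)
  have h2 := card_sdiff_add_card_eq_card (s := {A, B}) (t := ρ.1.parts) (by
    simp [insert_subset_iff, hA, hB])
  rw [card_pair hAB] at h2
  rw [card_singleton] at h1
  rw [← h1, ← h2, hE]

theorem BondPath.cons_weight (p : BondPath G) (π : BondLattice G) (h : p.head ⋖ π) :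
    BondPath.weight (p.cons π h) = bondWeight π p.head * p.weight := by
  unfold BondPath.weight
  have hl : (p.cons π h).length = p.length + 1 := by simp
  rw [← Fin.prod_congr' _ hl.symm, Fin.prod_univ_succ]
  refine congrArg₂ _ ?_ (Finset.prod_congr rfl fun i _ => congrArg₂ _ ?_ ?_)
  · exact congrArg (bondWeight π) (RelSeries.cons_cast_succ p π h 0)
  · exact RelSeries.cons_cast_succ p π h i.castSucc
  · exact RelSeries.cons_cast_succ p π h i.succ

theorem BondPath.head_tail_covBy {p : BondPath G} (h : p.length ≠ 0) :
    (p.tail h).head ⋖ p.head :=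
  p.step ⟨0, Nat.pos_of_ne_zero h⟩

theorem BondPath.length_ne_zero {p : BondPath G} (h : p.head ≠ ⊥) (h' : p.last = ⊥) :
    p.length ≠ 0 := by
  intro h0
  refine h (h' ▸ ?_)
  change p 0 = p (Fin.last _)
  congr 1
  ext
  simp [h0]

/-- Each edge of a path splits a part into two, so a path to `0̂` has `#V - #π.parts` edges. -/
theorem BondPath.card_head_parts_add_length (p : BondPath G) (h : p.last = ⊥) :
    #p.head.1.parts + p.length = Fintype.card V := by
  induction p using RelSeries.inductionOn with
  | singleton x =>
    obtain rfl : x = ⊥ := h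
    exact Finpartition.card_bot _
  | cons p π hπ ih =>
    obtain ⟨S, A, B, hs⟩ := exists_isSplit_of_covBy (show p.head ⋖ π from hπ)
    have := ih (by simpa using h)
    have := hs.card_parts
    simp only [RelSeries.head_cons, RelSeries.cons_length]
    omega

open Classical in
/-- Removing the first edge of the paths from `π ≠ 0̂` to `0̂`. -/
theorem sum_bondPath_eq {π : BondLattice G} (h : π ≠ ⊥) :
    ∑ p : BondPath G with p.head = π ∧ p.last = ⊥, (-1) ^ p.length * p.weight =
      -∑ ρ : BondLattice G with ρ ⋖ π, bondWeight π ρ *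
        ∑ p : BondPath G with p.head = ρ ∧ p.last = ⊥, (-1) ^ p.length * p.weight := by
  have hlen : ∀ {p : BondPath G}, p.head = π → p.last = ⊥ → p.length ≠ 0 :=
    fun h1 h2 => BondPath.length_ne_zero (h1 ▸ h) h2
  have hrhs : ∑ ρ : BondLattice G with ρ ⋖ π, bondWeight π ρ *
        ∑ p : BondPath G with p.head = ρ ∧ p.last = ⊥, (-1) ^ p.length * p.weight =
      ∑ p : BondPath G with p.head ⋖ π ∧ p.last = ⊥,
        bondWeight π p.head * ((-1) ^ p.length * p.weight) := by
    simp only [mul_sum, sum_filter (s := (univ : Finset (BondPath G)))]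
    rw [sum_comm]
    refine sum_congr rfl fun p _ => ?_
    by_cases hp : p.last = ⊥
    · simp [hp]
    · simp [hp]
  rw [hrhs, ← sum_neg_distrib]
  refine sum_bij' (fun p hp => p.tail (hlen (mem_filter.1 hp).2.1 (mem_filter.1 hp).2.2))
    (fun p hp => p.cons π (mem_filter.1 hp).2.1) ?_ ?_ ?_ ?_ ?_
  · intro p hp
    obtain ⟨-, rfl, hp2⟩ := mem_filter.1 hp
    exact mem_filter.2 ⟨mem_univ _, BondPath.head_tail_covBy _, by simpa using hp2⟩
  · intro p hp
    simpa using (mem_filter.1 hp).2.2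
  · intro p hp
    obtain ⟨-, rfl, hp2⟩ := mem_filter.1 hp
    exact RelSeries.cons_self_tail (hlen rfl hp2)
  · intro p hp
    exact RelSeries.tail_cons p π _
  · intro p hp
    obtain ⟨-, rfl, hp2⟩ := mem_filter.1 hp
    have hl := hlen rfl hp2
    have hw := BondPath.cons_weight (p.tail hl) p.head (BondPath.head_tail_covBy hl)
    rw [RelSeries.cons_self_tail hl] at hw
    have hln : p.length = (p.tail hl).length + 1 := by
      simp only [RelSeries.tail_length]; omega
    rw [hw, hln, pow_succ]
    ring

open Classical in
theorem sum_bondPath_bot :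
    ∑ p : BondPath G with p.head = ⊥ ∧ p.last = ⊥, (-1) ^ p.length * p.weight = 1 := by
  have : (univ.filter fun p : BondPath G => p.head = ⊥ ∧ p.last = ⊥) =
      {RelSeries.singleton _ ⊥} := by
    ext p
    rw [mem_filter, mem_singleton]
    constructor
    · rintro ⟨-, h1, h2⟩
      induction p using RelSeries.inductionOn with
      | singleton x => exact congrArg _ h1
      | cons p π hπ ih =>
        obtain rfl : π = ⊥ := h1
        exact absurd (show p.head ⋖ ⊥ from hπ).lt not_lt_bot
    · rintro rfl
      exact ⟨mem_univ _, rfl, rfl⟩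
  rw [this, sum_singleton]
  exact (mul_one _).trans (pow_zero _)

end Paths

/-! ### Path sums as signed counts -/

section SumOverPaths

variable {V : Type*} [Fintype V] [DecidableEq V] {G : SimpleGraph V}

open Classical in
theorem sum_bondPath_eq_signedCount (π : BondLattice G) :
    ∑ p : BondPath G with p.head = π ∧ p.last = ⊥, (-1) ^ p.length * p.weight =
      signedCount π := by
  induction π using WellFoundedLT.induction with
  | ind π ih =>
    by_cases h : π = ⊥
    · rw [h, sum_bondPath_bot, signedCount_bot]
    · rw [sum_bondPath_eq h, sum_congr rfl fun ρ hρ => by rw [ih ρ (mem_filter.1 hρ).2.lt],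
        sum_bondWeight_mul_signedCount h, neg_neg]

open Classical in
/-- Whitney's expansion, grouped by the components of the sets of edges. -/
theorem chromaticPolynomial_eq_sum_signedCount (G : SimpleGraph V) :
    G.chromaticPolynomial =
      ∑ π : BondLattice G, C (signedCount π) * X ^ #π.1.parts := by
  rw [chromaticPolynomial_eq_sum_powerset, ← sum_fiberwise _ (componentBond G)]
  refine sum_congr rfl fun π _ => ?_
  rw [signedCount, map_sum, sum_mul]
  exact sum_congr rfl fun F hF => by rw [(mem_filter.1 hF).2]

end SumOverPaths

end SimpleGraph

theorem theorem2 {V : Type*} [Fintype V] [DecidableEq V] (G : SimpleGraph V) :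
    G.chromaticPolynomial =
      ∑ p : G.BondPath with p.last = ⊥,
        C ((-1) ^ p.length * SimpleGraph.BondPath.weight p) *
          X ^ (Fintype.card V - p.length) := by
  classical
  rw [SimpleGraph.chromaticPolynomial_eq_sum_signedCount,
    ← sum_fiberwise _ (fun p : G.BondPath => p.head)]
  refine sum_congr rfl fun π _ => ?_
  rw [← SimpleGraph.sum_bondPath_eq_signedCount, map_sum, sum_mul, filter_filter]
  simp only [and_comm]
  refine sum_congr (by congr) fun p hp => ?_
  obtain ⟨-, hp⟩ := mem_filter.1 hp
  have := SimpleGraph.BondPath.card_head_parts_add_length p (by tauto)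
  obtain rfl : p.head = π := by tauto
  congr 2
  omega
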